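/- Let $p \ge 11$ be a prime, let $1 \le k < p$, let $H$ be a Sylow $p$-subgroup of the symmetric group $S_{pk}$, and let $H \times H$ act on $S_{pk}$ by $\sigma^{h,g} = h^{-1}\sigma g$. The orbits of this action are the double cosets $H\sigma H$; let $Z$ be their number. Let $P$ be the transition kernel on $S_{pk}$ of the Burnside process of this action, $$P(\sigma,\tau) = \frac{1}{|(H\times H)_\sigma|}\sum_{(h,g)\in (H\times H)_\sigma\cap (H\times H)_\tau}\frac{1}{|S_{pk}^{h,g}|},$$ where $(H\times H)_\sigma$ is the stabilizer of $\sigma$ and $S_{pk}^{h,g}=\{\tau \in S_{pk} : \tau^{h,g}=\tau\}$. Let $P^t_\sigma$ be the distribution after $t$ steps started at $\sigma$, let $\pi(\sigma)=\frac{1}{Z\,|H\sigma H|}$ be the stationary distribution of $P$, and let $\Vert\mu-\nu\Vert_{\mathrm{TV}}=\frac12\sum_{\tau}|\mu(\tau)-\nu(\tau)|$. Let $\sigma\in S_{pk}$ and let $a$ be such that $|H\sigma H| = p^a$. Then for all integers $t\ge 1$, $$\left|\,\Vert P^t_\sigma-\pi\Vert_{\mathrm{TV}} - 1 + \left(1-\left(1-\frac1p\right)^t\right)^{2k-a}\right|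 \le \frac{4p^4}{(p-1)!}+\frac{t}{(p-2)!}.$$ In particular, $$\Vert P^t_\sigma-\pi\Vert_{\mathrm{TV}} \le 1-\left(1-\left(1-\frac1p\right)^t\right)^{2k-a}+\frac{4p^4}{(p-1)!}+\frac{t}{(p-2)!}.$$ -/

import Mathlib

/-- Transition kernel of the Burnside process of a finite group `G` acting on `X`,
`P(x, y) = |G_x|⁻¹ ∑_{g ∈ G_x ∩ G_y} |X^g|⁻¹`: choose `g` uniformly in the stabilizer of `x`, then
choose `y` uniformly among the fixed points of `g`.
(A right action of `G` is an action of `Gᵐᵒᵖ`.) -/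
noncomputable def burnsideKernel (G X : Type*) [Group G] [Finite G] [MulAction G X] :
    Matrix X X ℝ := fun x y =>
  1 / (Nat.card (MulAction.stabilizer G x) : ℝ) *
    ∑ g ∈ (Set.toFinite {g : G | g • x = x ∧ g • y = y}).toFinset,
      1 / (Nat.card (MulAction.fixedBy X g) : ℝ)

/-- The distribution `π(x) = 1 / (Z |O_x|)`, where `O_x` is the orbit of `x` and `Z` is the number
of orbits. -/
noncomputable def burnsideStationary (G X : Type*) [Group G] [MulAction G X] : X → ℝ := fun x =>
  1 / ((Nat.card (MulAction.orbitRel.Quotient G X) : ℝ) * (Nat.card (MulAction.orbit G x) : ℝ))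

/-- Total variation distance between two probability mass functions on a finite set. -/
noncomputable def tvDist {X : Type*} [Fintype X] (μ ν : X → ℝ) : ℝ :=
  1 / 2 * ∑ x, |μ x - ν x|

/-- The right action `σ^{h, g} = h⁻¹ σ g` of `H × H` on the ambient group. -/
@[reducible]
def doubleCosetAction {Γ : Type*} [Group Γ] (H : Subgroup Γ) : MulAction (H × H)ᵐᵒᵖ Γ where
  smul c σ := (c.unop.1 : Γ)⁻¹ * σ * (c.unop.2 : Γ)
  one_smul σ := by
    change ((1 : Γ))⁻¹ * σ * (1 : Γ) = σ
    simp
  mul_smul c d σ := by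
    change ((d.unop.1 : Γ) * (c.unop.1 : Γ))⁻¹ * σ * ((d.unop.2 : Γ) * (c.unop.2 : Γ)) =
      (c.unop.1 : Γ)⁻¹ * ((d.unop.1 : Γ)⁻¹ * σ * (d.unop.2 : Γ)) * (c.unop.2 : Γ)
    group

/-- Kernel of the Burnside process for the `H`-double cosets of a finite group. -/
noncomputable def doubleCosetKernel {Γ : Type*} [Group Γ] [Finite Γ] (H : Subgroup Γ) :
    Matrix Γ Γ ℝ :=
  letI := doubleCosetAction H
  haveI : Finite (H × H)ᵐᵒᵖ := Finite.of_equiv _ MulOpposite.opEquiv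
  burnsideKernel (H × H)ᵐᵒᵖ Γ

/-- Stationary distribution of the Burnside process for the `H`-double cosets of a finite group. -/
noncomputable def doubleCosetStationary {Γ : Type*} [Group Γ] (H : Subgroup Γ) : Γ → ℝ :=
  letI := doubleCosetAction H
  burnsideStationary (H × H)ᵐᵒᵖ Γ

/-!
The Burnside process picks a random element of the stabilizer of the current state and then a random
fixed point of that element. For `k < p` the group `H` is generated by `k` disjoint `p`-cycles, so
after a choice of coordinates `e : Fin (p * k) ≃ Fin k × ZMod p` it consists of the block rotations
`blockRotation e x` with `x : Fin k → ZMod p` (`exists_blockRotation_of_sylow`).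

The stabilizer of `σ` is isomorphic to `H ∩ σHσ⁻¹`. An element of this intersection splits into its
`p`-cycles, each of which lies in the intersection again, so the intersection is the coordinate
subspace of a set `commonBlocks e σ` of blocks (`exists_intertwine_iff`); its size is
`D σ = 2k - a`. A uniform element of the stabilizer keeps each of these coordinates nonzero with
probability `1 - 1/p`, independently. If `T` is the set of the coordinates kept, the next state `τ`
conjugates one given block rotation to another of support `T`, so its common blocks contain `T`;
a block outside `T` is common only with small probability. Indeed all `p`-cycles on the points
outside `T` are equally likely images of a given `p`-cycle, and a union bound shows that the expected
number of additional common blocks is at most `δ = 1/(p-2)!` (`sum_excess_commonBlocks_le`).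

The structure `HasHammingStabilizers` records just these facts, and the rest is about any action that
satisfies them. With `r_s = 1 - (1 - 1/p)^s` the functions `f_s = r_s ^ D` satisfy
`f_{s+1} - δ ≤ P f_s ≤ f_{s+1}`, hence `f_{s+t} - tδ ≤ P^t f_s ≤ f_{s+t}` (`le_pow_mulVec`,
`pow_mulVec_le`).

* Since `f_0` is the indicator of `D = 0`, the chain has `D = 0` at time `t` with probability at most
  `f_t`, whereas `π(D ≠ 0) ≤ pδ` (`sum_stationary_ne_zero_le`). This bounds the distance from below.
* Since the identity of the group is drawn with probability `p ^ (-D) = f_1` and leads to a uniform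
  state, `P^t ≥ P^(t-1) f_1 / |X| ≥ (f_t - (t-1)δ) / |X|` (`le_pow_succ_apply`). On `D = 0` the
  uniform distribution dominates `π`, so this bounds the distance from above.

The bound on `π(D ≠ 0)` needs no counting of double cosets. Choose the state from `π` and then a
uniform element of its stabilizer: the mean of `D` minus the weight of that element is the `π`-mean
of `D/p` if the state is fixed first, and at most `δ` if the element is.
-/

/-! ### Total variation distance -/

section TotalVariation

variable {X : Type*} [Fintype X]

theorem sum_sub_le_tvDist {μ ν : X → ℝ} (h : ∑ x, μ x = ∑ x, ν x) (A : Finset X) :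
    ∑ x ∈ A, (ν x - μ x) ≤ tvDist μ ν := by
  classical
  have h1 : ∑ x ∈ A, (ν x - μ x) + ∑ x ∈ Aᶜ, (ν x - μ x) = 0 := by
    rw [Finset.sum_add_sum_compl, Finset.sum_sub_distrib, h, sub_self]
  have h2 : ∑ x ∈ A, (ν x - μ x) ≤ ∑ x ∈ A, |μ x - ν x| :=
    Finset.sum_le_sum fun x _ => by rw [abs_sub_comm]; exact le_abs_self _
  have h3 : -∑ x ∈ Aᶜ, (ν x - μ x) ≤ ∑ x ∈ Aᶜ, |μ x - ν x| := by
    rw [← Finset.sum_neg_distrib]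
    exact Finset.sum_le_sum fun x _ => by rw [neg_sub]; exact le_abs_self _
  have h4 := Finset.sum_add_sum_compl A fun x => |μ x - ν x|
  rw [tvDist, ← h4]
  linarith

theorem tvDist_le_sum {μ ν b : X → ℝ} (h : ∑ x, μ x = ∑ x, ν x) (hb : ∀ x, 0 ≤ b x)
    (hle : ∀ x, ν x - μ x ≤ b x) : tvDist μ ν ≤ ∑ x, b x := by
  have h1 : ∑ x, |μ x - ν x| ≤ ∑ x, (2 * b x + (μ x - ν x)) := by
    refine Finset.sum_le_sum fun x _ => abs_le.2 ⟨?_, ?_⟩ <;> linarith [hb x, hle x]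
  rw [Finset.sum_add_distrib, Finset.sum_sub_distrib, h, sub_self, add_zero,
    ← Finset.mul_sum] at h1
  rw [tvDist]
  linarith

end TotalVariation

/-! ### Burnside processes with Hamming-weight stabilizers -/

section Burnside

open Matrix

variable {G X : Type*} [Group G] [MulAction G X]

open Classical in
theorem card_fixedBy_eq [Fintype X] (g : G) :
    Nat.card (MulAction.fixedBy X g) = (Finset.univ.filter fun y : X => g • y = y).card := by
  rw [Nat.card_eq_fintype_card, Fintype.card_subtype]
  simp [MulAction.mem_fixedBy]

variable [Fintype G]

open Classical in
theorem card_stabilizer_eq (x : X) :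
    Nat.card (MulAction.stabilizer G x) = (Finset.univ.filter fun g : G => g • x = x).card := by
  rw [Nat.card_eq_fintype_card, Fintype.card_subtype]
  simp [MulAction.mem_stabilizer_iff]

open Classical in
theorem burnsideKernel_eq (x y : X) :
    burnsideKernel G X x y = (∑ g : G, if g • x = x then
      (if g • y = y then ((Nat.card (MulAction.fixedBy X g) : ℝ))⁻¹ else 0) else 0) /
        (Nat.card (MulAction.stabilizer G x) : ℝ) := by
  have : (Set.toFinite {g : G | g • x = x ∧ g • y = y}).toFinset =
      Finset.univ.filter fun g : G => g • x = x ∧ g • y = y := by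
    ext g; simp
  simp only [burnsideKernel, this, Finset.sum_filter, div_eq_inv_mul, mul_one, ite_and]

theorem burnsideKernel_nonneg (x y : X) : 0 ≤ burnsideKernel G X x y := by
  rw [burnsideKernel]
  positivity

variable [Fintype X]

open Classical in
/-- One step of the Burnside process, averaging a function: the mean over the stabilizer of the
means over the fixed-point sets. -/
theorem burnsideKernel_mulVec (f : X → ℝ) (x : X) :
    (burnsideKernel G X *ᵥ f) x = (∑ g : G, if g • x = x then
      (∑ y with g • y = y, f y) / (Nat.card (MulAction.fixedBy X g) : ℝ) else 0) /
        (Nat.card (MulAction.stabilizer G x) : ℝ) := by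
  simp only [mulVec, dotProduct, burnsideKernel_eq, div_mul_eq_mul_div, ← Finset.sum_div,
    Finset.sum_mul]
  rw [Finset.sum_comm]
  congr 1
  refine Finset.sum_congr rfl fun g _ => ?_
  split_ifs with hg
  · rw [Finset.sum_filter, Finset.sum_div]
    refine Finset.sum_congr rfl fun y _ => ?_
    split_ifs <;> simp [div_eq_inv_mul]
  · simp

theorem burnsideKernel_mulVec_mono {f f' : X → ℝ} (h : ∀ x, f x ≤ f' x) (x : X) :
    (burnsideKernel G X *ᵥ f) x ≤ (burnsideKernel G X *ᵥ f') x :=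
  Finset.sum_le_sum fun y _ => mul_le_mul_of_nonneg_left (h y) (burnsideKernel_nonneg x y)

theorem burnsideKernel_mulVec_const (c : ℝ) (x : X) :
    (burnsideKernel G X *ᵥ fun _ => c) x = c := by
  classical
  have hs : (Nat.card (MulAction.stabilizer G x) : ℝ) ≠ 0 := by
    exact_mod_cast Nat.card_pos.ne'
  rw [burnsideKernel_mulVec, div_eq_iff hs, card_stabilizer_eq, ← Finset.sum_filter,
    mul_comm, ← nsmul_eq_mul]
  refine Finset.sum_eq_card_nsmul fun g hg => ?_
  have hx : x ∈ Finset.univ.filter fun y : X => g • y = y := by simpa using hg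
  have hne : ((Finset.univ.filter fun y : X => g • y = y).card : ℝ) ≠ 0 := by
    exact_mod_cast (Finset.card_pos.2 ⟨x, hx⟩).ne'
  rw [card_fixedBy_eq, Finset.sum_const, nsmul_eq_mul, mul_div_cancel_left₀ _ hne]

theorem burnsideKernel_pow_nonneg [DecidableEq X] (t : ℕ) (x y : X) :
    0 ≤ (burnsideKernel G X ^ t) x y := by
  induction t generalizing y with
  | zero => rw [pow_zero, Matrix.one_apply]; split_ifs <;> norm_num
  | succ t ih =>
    rw [pow_succ (burnsideKernel G X), Matrix.mul_apply]
    exact Finset.sum_nonneg fun z _ => mul_nonneg (ih z) (burnsideKernel_nonneg z y)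

theorem sum_burnsideKernel_pow [DecidableEq X] (t : ℕ) (x : X) :
    ∑ y, (burnsideKernel G X ^ t) x y = 1 := by
  have : ∀ x, ((burnsideKernel G X ^ t) *ᵥ fun _ => (1 : ℝ)) x = 1 := by
    induction t with
    | zero => simp
    | succ t ih =>
      intro x
      have h1 : ((burnsideKernel G X ^ t) *ᵥ fun _ => (1 : ℝ)) = fun _ => 1 := funext ih
      rw [pow_succ', ← mulVec_mulVec, h1, burnsideKernel_mulVec_const]
  simpa [mulVec, dotProduct] using this x

open Classical in
/-- Numerical shadow of an action all of whose stabilizers look like `𝔽_p ^ D x` with `w` the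
Hamming weight: `w` is at most `D x` on the stabilizer of `x`, its generating function there is that
of the Hamming weight, and a uniform fixed point of `g` has stabilizer of rank at most `w g + δ` on
average. -/
structure HasHammingStabilizers (D : X → ℕ) (w : G → ℕ) (p : ℕ) (δ : ℝ) : Prop where
  weight_le : ∀ g x, g • x = x → w g ≤ D x
  sum_pow_weight : ∀ (x : X) (r : ℝ),
    ∑ g with g • x = x, r ^ w g = (1 + ((p : ℝ) - 1) * r) ^ D x
  sum_excess_le : ∀ g : G, ∑ x with g • x = x, ((D x : ℝ) - w g) ≤
    δ * ((Finset.univ.filter fun x : X => g • x = x).card : ℝ)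

namespace HasHammingStabilizers

variable {D : X → ℕ} {w : G → ℕ} {p : ℕ} {δ : ℝ}

theorem card_stabilizer (h : HasHammingStabilizers D w p δ) (x : X) :
    (Nat.card (MulAction.stabilizer G x) : ℝ) = (p : ℝ) ^ D x := by
  classical
  have := h.sum_pow_weight x 1
  simpa only [card_stabilizer_eq, one_pow, Finset.sum_const, nsmul_eq_mul, mul_one,
    add_sub_cancel] using this

theorem delta_nonneg [Nonempty X] (h : HasHammingStabilizers D w p δ) : 0 ≤ δ := by
  classical
  have h1 := h.sum_excess_le 1
  obtain ⟨x⟩ := ‹Nonempty X›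
  have h0 : 0 ≤ ∑ x with (1 : G) • x = x, ((D x : ℝ) - w (1 : G)) :=
    Finset.sum_nonneg fun y hy => by
      have := h.weight_le 1 y (one_smul _ _)
      rw [sub_nonneg]; exact_mod_cast this
  have hc : (0 : ℝ) < ((Finset.univ.filter fun x : X => (1 : G) • x = x).card : ℝ) := by
    exact_mod_cast Finset.card_pos.2 ⟨x, by simp⟩
  exact nonneg_of_mul_nonneg_left (h0.trans h1) hc

/-- Recursion for the probability that a coordinate which survives each step with probability
`1 - 1/p` is dead after `s + 1` steps, by conditioning on the first step. -/
theorem one_sub_pow_succ (hp : 1 ≤ p) (s : ℕ) :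
    1 - (1 - 1 / (p : ℝ)) ^ (s + 1) =
      (1 + ((p : ℝ) - 1) * (1 - (1 - 1 / (p : ℝ)) ^ s)) / p := by
  have : (p : ℝ) ≠ 0 := by positivity
  rw [pow_succ]
  field_simp
  ring

theorem one_sub_pow_mem (hp : 1 ≤ p) (s : ℕ) :
    0 ≤ 1 - (1 - 1 / (p : ℝ)) ^ s ∧ 1 - (1 - 1 / (p : ℝ)) ^ s ≤ 1 := by
  have h1 : (1 : ℝ) ≤ p := by exact_mod_cast hp
  have h2 : 1 / (p : ℝ) ≤ 1 := by rw [div_le_one (by positivity)]; exact h1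
  have h3 : 0 ≤ 1 / (p : ℝ) := by positivity
  constructor
  · linarith [pow_le_one₀ (n := s) (sub_nonneg.2 h2) (by linarith)]
  · linarith [pow_nonneg (sub_nonneg.2 h2) s]

theorem mulVec_pow_le (h : HasHammingStabilizers D w p δ) (hp : 1 ≤ p) {r : ℝ} (h0 : 0 ≤ r)
    (h1 : r ≤ 1) (x : X) :
    (burnsideKernel G X *ᵥ fun y => r ^ D y) x ≤ ((1 + ((p : ℝ) - 1) * r) / p) ^ D x := by
  classical
  have hs : (0 : ℝ) < (p : ℝ) ^ D x := by positivity
  rw [burnsideKernel_mulVec, h.card_stabilizer, div_pow, ← h.sum_pow_weight,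
    ← Finset.sum_filter]
  refine div_le_div_of_nonneg_right (Finset.sum_le_sum fun g hg => ?_) hs.le
  have hx : x ∈ Finset.univ.filter fun y : X => g • y = y := by simpa using hg
  have hpos : (0 : ℝ) < ((Finset.univ.filter fun y : X => g • y = y).card : ℝ) := by
    exact_mod_cast (Finset.card_pos.2 ⟨x, hx⟩)
  rw [card_fixedBy_eq, div_le_iff₀ hpos, mul_comm, ← nsmul_eq_mul]
  refine Finset.sum_le_card_nsmul _ _ _ fun y hy => ?_
  exact pow_le_pow_of_le_one h0 h1 (h.weight_le g y (by simpa using hy))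

theorem le_mulVec_pow (h : HasHammingStabilizers D w p δ) (hp : 1 ≤ p) {r : ℝ} (h0 : 0 ≤ r)
    (h1 : r ≤ 1) (x : X) :
    ((1 + ((p : ℝ) - 1) * r) / p) ^ D x - δ ≤ (burnsideKernel G X *ᵥ fun y => r ^ D y) x := by
  classical
  have hs : (0 : ℝ) < (p : ℝ) ^ D x := by positivity
  have hc : δ * (p : ℝ) ^ D x = ∑ g : G with g • x = x, δ := by
    rw [← h.card_stabilizer, card_stabilizer_eq, Finset.sum_const, nsmul_eq_mul, mul_comm]
  rw [burnsideKernel_mulVec, h.card_stabilizer, le_div_iff₀ hs, sub_mul, div_pow,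
    div_mul_cancel₀ _ hs.ne', ← h.sum_pow_weight, ← Finset.sum_filter, hc,
    ← Finset.sum_sub_distrib]
  refine Finset.sum_le_sum fun g hg => ?_
  have hx : x ∈ Finset.univ.filter fun y : X => g • y = y := by simpa using hg
  have hpos : (0 : ℝ) < ((Finset.univ.filter fun y : X => g • y = y).card : ℝ) := by
    exact_mod_cast (Finset.card_pos.2 ⟨x, hx⟩)
  rw [card_fixedBy_eq, le_div_iff₀ hpos, sub_mul, sub_le_iff_le_add, mul_comm, ← nsmul_eq_mul,
    ← Finset.sum_const]
  refine le_trans ?_ (add_le_add_right (h.sum_excess_le g) _)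
  rw [← Finset.sum_add_distrib]
  refine Finset.sum_le_sum fun y hy => ?_
  have hw := h.weight_le g y (by simpa using hy)
  -- `r ^ w - r ^ D` vanishes if `w = D` and is at most `1 ≤ D - w` otherwise.
  rcases hw.eq_or_lt with hw | hw
  · simp [hw]
  · have h2 : r ^ w g ≤ 1 := pow_le_one₀ h0 h1
    have h3 : 0 ≤ r ^ D y := pow_nonneg h0 _
    have h4 : (w g : ℝ) + 1 ≤ D y := by exact_mod_cast hw
    linarith

/-- The identity of `G` is drawn with probability `p ^ (-D z)`, and it leads to a uniform state. -/
theorem le_burnsideKernel (h : HasHammingStabilizers D w p δ) (z y : X) :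
    (1 - (1 - 1 / (p : ℝ)) ^ 1) ^ D z / Fintype.card X ≤ burnsideKernel G X z y := by
  classical
  rw [burnsideKernel_eq, h.card_stabilizer, pow_one, sub_sub_cancel, div_pow, one_pow,
    div_div, mul_comm, ← div_div]
  refine div_le_div_of_nonneg_right ?_ (by positivity)
  refine le_trans ?_ (Finset.single_le_sum (f := fun g : G => if g • z = z then
    (if g • y = y then ((Nat.card (MulAction.fixedBy X g) : ℝ))⁻¹ else 0) else 0)
    (fun g _ => by positivity) (Finset.mem_univ 1))
  simp

/-- By the orbit-stabilizer theorem and Burnside's lemma the stationary distribution is proportional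
to the order of the stabilizer. -/
theorem stationary_eq (h : HasHammingStabilizers D w p δ) (x : X) :
    burnsideStationary G X x = (p : ℝ) ^ D x / ∑ y, (p : ℝ) ^ D y := by
  classical
  have h1 := MulAction.sum_card_fixedBy_eq_card_orbits_mul_card_group G X
  have h2 : ∑ y, (p : ℝ) ^ D y =
      Nat.card (MulAction.orbitRel.Quotient G X) * Fintype.card G := by
    have h3 : ∑ y : X, Nat.card (MulAction.stabilizer G y) =
        ∑ g : G, Fintype.card (MulAction.fixedBy X g) := by
      simp only [card_stabilizer_eq, ← Nat.card_eq_fintype_card, card_fixedBy_eq,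
        Finset.card_filter]
      exact Finset.sum_comm
    rw [← h3, ← Nat.card_eq_fintype_card] at h1
    simp only [← h.card_stabilizer]
    exact_mod_cast h1
  have h4 := MulAction.card_orbit_mul_card_stabilizer_eq_card_group G x
  have h5 : (Nat.card (MulAction.orbit G x) : ℝ) * (p : ℝ) ^ D x = Fintype.card G := by
    rw [← h.card_stabilizer, Nat.card_eq_fintype_card, Nat.card_eq_fintype_card]
    exact_mod_cast h4
  have h6 : (Nat.card (MulAction.stabilizer G x) : ℝ) ≠ 0 := by
    exact_mod_cast Nat.card_pos.ne'
  rw [h.card_stabilizer] at h6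
  rw [burnsideStationary, h2, ← h5, ← mul_assoc, mul_comm _ ((p : ℝ) ^ D x),
    div_mul_cancel_left₀ h6, one_div]

open Classical in
/-- Differentiating the generating function of the weight at `1`: the mean excess `D x - w g` over
the stabilizer of `x` is `D x / p`. -/
theorem sum_sub_weight (h : HasHammingStabilizers D w p δ) (x : X) :
    p * ∑ g with g • x = x, ((D x : ℝ) - w g) = D x * (p : ℝ) ^ D x := by
  have h1 : HasDerivAt (fun r : ℝ => ∑ g with g • x = x, r ^ w g)
      (∑ g with g • x = x, (w g : ℝ)) 1 := by
    refine HasDerivAt.fun_sum fun g _ => ?_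
    simpa using hasDerivAt_pow (w g) (1 : ℝ)
  have h2 : HasDerivAt (fun r : ℝ => (1 + ((p : ℝ) - 1) * r) ^ D x)
      (D x * (p : ℝ) ^ (D x - 1) * ((p : ℝ) - 1)) 1 := by
    have := (((hasDerivAt_id (1 : ℝ)).const_mul ((p : ℝ) - 1)).const_add 1).pow (D x)
    simp only [id, mul_one, add_sub_cancel] at this
    exact this
  have h3 := h1.unique ((funext fun r => h.sum_pow_weight x r) ▸ h2)
  have h4 : ∑ g : G with g • x = x, (D x : ℝ) = D x * (p : ℝ) ^ D x := by
    rw [← h.card_stabilizer, card_stabilizer_eq, Finset.sum_const, nsmul_eq_mul, mul_comm]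
  rw [Finset.sum_sub_distrib, h3, h4]
  rcases Nat.eq_zero_or_pos (D x) with h0 | h0
  · simp [h0]
  · obtain ⟨n, hn⟩ := Nat.exists_eq_succ_of_ne_zero h0.ne'
    rw [hn, Nat.succ_sub_one, pow_succ]
    ring

/-- States with a nontrivial stabilizer are rare under the stationary distribution. Over all pairs
`(g, x)` with `g • x = x` the mean of `D x - w g` is at most `δ`, because it is for fixed `g`; and
for fixed `x` it is `D x / p`. -/
theorem sum_stationary_ne_zero_le [Nonempty X] (h : HasHammingStabilizers D w p δ) (hp : 1 ≤ p) :
    ∑ x, (if D x = 0 then 0 else burnsideStationary G X x) ≤ p * δ := by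
  classical
  have hpow : ∀ x, (0 : ℝ) < (p : ℝ) ^ D x := fun x => by positivity
  have hW : 0 < ∑ y, (p : ℝ) ^ D y :=
    Finset.sum_pos (fun x _ => hpow x) Finset.univ_nonempty
  have h1 : ∑ x, ∑ g : G with g • x = x, ((D x : ℝ) - w g) ≤ δ * ∑ y, (p : ℝ) ^ D y := by
    simp only [← h.card_stabilizer, card_stabilizer_eq, Finset.sum_filter]
    have h2 : ∑ x : X, ((Finset.univ.filter fun g : G => g • x = x).card : ℝ) =
        ∑ g : G, ((Finset.univ.filter fun x : X => g • x = x).card : ℝ) := by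
      simp only [Finset.card_filter, Nat.cast_sum]
      exact Finset.sum_comm
    rw [h2, Finset.sum_comm, Finset.mul_sum]
    refine Finset.sum_le_sum fun g _ => ?_
    rw [← Finset.sum_filter]
    exact h.sum_excess_le g
  have h3 : ∑ x, (D x : ℝ) * (p : ℝ) ^ D x ≤ p * δ * ∑ y, (p : ℝ) ^ D y := by
    simp only [← h.sum_sub_weight, ← Finset.mul_sum]
    rw [mul_assoc]
    exact mul_le_mul_of_nonneg_left h1 (by positivity)
  refine le_trans ?_ ((div_le_iff₀ hW).2 h3)
  rw [Finset.sum_div]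
  refine Finset.sum_le_sum fun x _ => ?_
  split_ifs with hx
  · simp [hx]
  · rw [h.stationary_eq]
    refine div_le_div_of_nonneg_right ?_ hW.le
    have : (1 : ℝ) ≤ D x := by exact_mod_cast Nat.one_le_iff_ne_zero.2 hx
    nlinarith [hpow x]

theorem sum_stationary [Nonempty X] (h : HasHammingStabilizers D w p δ) (hp : 1 ≤ p) :
    ∑ x, burnsideStationary G X x = 1 := by
  have hW : 0 < ∑ y, (p : ℝ) ^ D y :=
    Finset.sum_pos (fun x _ => by positivity) Finset.univ_nonempty
  simp only [h.stationary_eq, ← Finset.sum_div]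
  exact div_self hW.ne'

variable [DecidableEq X]

theorem pow_mulVec_le (h : HasHammingStabilizers D w p δ) (hp : 1 ≤ p) (s t : ℕ) (x : X) :
    ((burnsideKernel G X ^ t) *ᵥ fun y => (1 - (1 - 1 / (p : ℝ)) ^ s) ^ D y) x ≤
      (1 - (1 - 1 / (p : ℝ)) ^ (s + t)) ^ D x := by
  induction t generalizing x with
  | zero => simp
  | succ t ih =>
    rw [pow_succ', ← mulVec_mulVec, ← add_assoc, one_sub_pow_succ hp]
    exact (burnsideKernel_mulVec_mono ih x).trans
      (h.mulVec_pow_le hp (one_sub_pow_mem hp _).1 (one_sub_pow_mem hp _).2 x)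

theorem le_pow_mulVec (h : HasHammingStabilizers D w p δ) (hp : 1 ≤ p) (s t : ℕ) (x : X) :
    (1 - (1 - 1 / (p : ℝ)) ^ (s + t)) ^ D x - t * δ ≤
    ((burnsideKernel G X ^ t) *ᵥ fun y => (1 - (1 - 1 / (p : ℝ)) ^ s) ^ D y) x := by
  induction t generalizing x with
  | zero => simp
  | succ t ih =>
    rw [pow_succ', ← mulVec_mulVec, ← add_assoc, one_sub_pow_succ hp]
    refine le_trans ?_ (burnsideKernel_mulVec_mono ih x)
    have h1 := h.le_mulVec_pow hp (one_sub_pow_mem (p := p) hp (s + t)).1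
      (one_sub_pow_mem hp _).2 x
    have h2 : (burnsideKernel G X *ᵥ fun y =>
        (1 - (1 - 1 / (p : ℝ)) ^ (s + t)) ^ D y - t * δ) x =
        (burnsideKernel G X *ᵥ fun y => (1 - (1 - 1 / (p : ℝ)) ^ (s + t)) ^ D y) x - t * δ := by
      have := mulVec_sub (burnsideKernel G X)
        (fun y => (1 - (1 - 1 / (p : ℝ)) ^ (s + t)) ^ D y) (fun _ => (t : ℝ) * δ)
      have h3 := congrFun this x
      rw [Pi.sub_apply, burnsideKernel_mulVec_const] at h3
      exact h3
    rw [h2]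
    push_cast
    linarith

theorem le_pow_succ_apply (h : HasHammingStabilizers D w p δ) (hp : 1 ≤ p) (t : ℕ) (x y : X) :
    ((1 - (1 - 1 / (p : ℝ)) ^ (t + 1)) ^ D x - t * δ) / Fintype.card X ≤
      (burnsideKernel G X ^ (t + 1)) x y := by
  classical
  have hone := fun z => h.le_burnsideKernel z y
  have hN : (0 : ℝ) ≤ Fintype.card X := by positivity
  have h1 := h.le_pow_mulVec hp 1 t x
  rw [add_comm 1 t] at h1
  refine (div_le_div_of_nonneg_right h1 hN).trans ?_
  rw [pow_succ (burnsideKernel G X), Matrix.mul_apply]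
  simp only [mulVec, dotProduct, Finset.sum_div, mul_div_assoc]
  exact Finset.sum_le_sum fun z _ =>
    mul_le_mul_of_nonneg_left (hone z) (burnsideKernel_pow_nonneg t x z)

/-- Before the identity has been drawn, the chain sits among the rare states with a nontrivial
stabilizer; afterwards it is nearly stationary. -/
theorem abs_tvDist_sub_le [Nonempty X] (h : HasHammingStabilizers D w p δ) (hp : 1 ≤ p) {t : ℕ}
    (ht : 1 ≤ t) (x : X) :
    |tvDist ((burnsideKernel G X ^ t) x) (burnsideStationary G X) - 1 +
      (1 - (1 - 1 / (p : ℝ)) ^ t) ^ D x| ≤ p * δ + t * δ := by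
  have hδ := h.delta_nonneg
  have hpow : ∀ y, (0 : ℝ) < (p : ℝ) ^ D y := fun y => by positivity
  have hW : 0 < ∑ y, (p : ℝ) ^ D y :=
    Finset.sum_pos (fun y _ => hpow y) Finset.univ_nonempty
  have hπ : ∀ y, 0 ≤ burnsideStationary G X y := fun y => by
    rw [h.stationary_eq]; exact div_nonneg (hpow y).le hW.le
  have hsum : ∑ y, (burnsideKernel G X ^ t) x y = ∑ y, burnsideStationary G X y := by
    rw [sum_burnsideKernel_pow, h.sum_stationary hp]
  have hrare := h.sum_stationary_ne_zero_le hp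
  have hq1 : (1 - (1 - 1 / (p : ℝ)) ^ t) ^ D x ≤ 1 :=
    pow_le_one₀ (one_sub_pow_mem hp t).1 (one_sub_pow_mem hp t).2
  rw [abs_le]
  constructor
  · have h1 := sum_sub_le_tvDist hsum (Finset.univ.filter fun y => D y = 0)
    have h2 : ∑ y with D y = 0, (burnsideKernel G X ^ t) x y ≤
        (1 - (1 - 1 / (p : ℝ)) ^ t) ^ D x := by
      have := h.pow_mulVec_le hp 0 t x
      simpa [mulVec, dotProduct, zero_pow_eq, Finset.sum_filter] using this
    have h3 : 1 - p * δ ≤ ∑ y with D y = 0, burnsideStationary G X y := by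
      rw [← h.sum_stationary hp, sub_le_iff_le_add, Finset.sum_filter]
      refine le_trans ?_ (add_le_add_right hrare _)
      rw [← Finset.sum_add_distrib]
      refine Finset.sum_le_sum fun y _ => ?_
      split_ifs <;> simp
    rw [Finset.sum_sub_distrib] at h1
    have : 0 ≤ (t : ℝ) * δ := by positivity
    linarith
  · obtain ⟨s, rfl⟩ := Nat.exists_eq_add_of_le' ht
    -- `P ^ t` dominates `c` times the uniform distribution, and so `c * π` on `D = 0`
    set c := (1 - (1 - 1 / (p : ℝ)) ^ (s + 1)) ^ D x - s * δ with hc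
    have hc1 : c ≤ 1 := by
      have : 0 ≤ (s : ℝ) * δ := by positivity
      linarith
    have h1 := tvDist_le_sum (b := fun y => (1 - c) * burnsideStationary G X y +
        if D y = 0 then 0 else burnsideStationary G X y) hsum
      (fun y => by
        have := mul_nonneg (sub_nonneg.2 hc1) (hπ y)
        have := hπ y
        split_ifs <;> linarith) ?_
    · rw [Finset.sum_add_distrib, ← Finset.mul_sum, h.sum_stationary hp] at h1
      push_cast
      linarith
    · intro y
      have hnn := burnsideKernel_pow_nonneg (G := G) (s + 1) x y
      split_ifs with hy
      · suffices c * burnsideStationary G X y ≤ (burnsideKernel G X ^ (s + 1)) x y by linarith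
        rcases le_total c 0 with h0 | h0
        · exact (mul_nonpos_of_nonpos_of_nonneg h0 (hπ y)).trans hnn
        · refine le_trans ?_ (h.le_pow_succ_apply hp s x y)
          rw [h.stationary_eq, hy, pow_zero, mul_one_div]
          have hN : (0 : ℝ) < Fintype.card X := by exact_mod_cast Fintype.card_pos
          refine div_le_div_of_nonneg_left h0 hN ?_
          have hcard : (Fintype.card X : ℝ) = ∑ _y : X, (1 : ℝ) := by simp
          rw [hcard]
          exact Finset.sum_le_sum fun z _ => one_le_pow₀ (by exact_mod_cast hp)
      · have := mul_nonneg (sub_nonneg.2 hc1) (hπ y)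
        linarith

end HasHammingStabilizers
end Burnside

/-! ### Block rotations -/

section BlockRotation

open Equiv

variable {ι α : Type*} {p : ℕ}

/-- A bijection `e : α ≃ ι × ZMod p` divides `α` into cyclically ordered blocks of length `p`
indexed by `ι`; the block rotation by `x` advances the block `i` by `x i` steps. -/
def blockRotation (e : α ≃ ι × ZMod p) (x : ι → ZMod p) : Perm α where
  toFun a := e.symm ((e a).1, (e a).2 + x (e a).1)
  invFun a := e.symm ((e a).1, (e a).2 - x (e a).1)
  left_inv a := by simp
  right_inv a := by simp

variable (e : α ≃ ι × ZMod p)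

theorem apply_blockRotation (x : ι → ZMod p) (a : α) :
    e (blockRotation e x a) = ((e a).1, (e a).2 + x (e a).1) := by
  simp [blockRotation]

theorem blockRotation_zero : blockRotation e 0 = 1 := by
  ext a; apply e.injective; simp [apply_blockRotation]

theorem blockRotation_add (x y : ι → ZMod p) :
    blockRotation e (x + y) = blockRotation e x * blockRotation e y := by
  ext a
  apply e.injective
  simp [apply_blockRotation, add_assoc, add_comm (x _)]

theorem blockRotation_apply_eq_self {x : ι → ZMod p} {a : α} :
    blockRotation e x a = a ↔ x (e a).1 = 0 := by
  rw [← e.injective.eq_iff, apply_blockRotation, Prod.ext_iff]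
  simp

theorem blockRotation_congr {x x' : ι → ZMod p} {a : α} (h : x (e a).1 = x' (e a).1) :
    blockRotation e x a = blockRotation e x' a := by
  apply e.injective
  rw [apply_blockRotation, apply_blockRotation, h]

theorem blockRotation_injective : Function.Injective (blockRotation e) := by
  intro x y h
  funext i
  have h1 := congrArg (fun g : Perm α => (e (g (e.symm (i, 0)))).2) h
  simpa [apply_blockRotation] using h1

/-- Block rotations form a vector space, and intertwining is compatible with scalars. -/
theorem intertwine_smul [NeZero p] {x y : ι → ZMod p} {τ : Perm α}
    (h : τ * blockRotation e y = blockRotation e x * τ) (z : ZMod p) :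
    τ * blockRotation e (z • y) = blockRotation e (z • x) * τ := by
  have hn : ∀ n : ℕ, τ * blockRotation e (n • y) = blockRotation e (n • x) * τ := by
    intro n
    induction n with
    | zero => simp [blockRotation_zero]
    | succ n ih =>
      rw [succ_nsmul, succ_nsmul, blockRotation_add, blockRotation_add, ← mul_assoc, ih,
        mul_assoc, h, mul_assoc]
  have := hn z.val
  rwa [← Nat.cast_smul_eq_nsmul (ZMod p), ← Nat.cast_smul_eq_nsmul (ZMod p),
    ZMod.natCast_zmod_val] at this

/-- The blocks of an intertwiner correspond: if `τ` conjugates a block rotation to one that moves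
the block `i`, then it maps some block `j` onto the block `i` and conjugates a rotation of the
block `j` alone to the unit rotation of the block `i`. -/
theorem exists_single_intertwine [DecidableEq ι] [Fact p.Prime] {x y : ι → ZMod p} {τ : Perm α}
    (h : τ * blockRotation e y = blockRotation e x * τ) {i : ι} (hi : x i ≠ 0) :
    ∃ j f, f ≠ 0 ∧ τ * blockRotation e (Pi.single j f) =
      blockRotation e (Pi.single i 1) * τ := by
  wlog h1 : x i = 1 generalizing x y
  · exact this (intertwine_smul e h (x i)⁻¹) (by simp [hi]) (by simp [hi])
  have hz : ∀ z a, τ (blockRotation e (z • y) a) = blockRotation e (z • x) (τ a) := fun z a =>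
    congrArg (fun g : Perm α => g a) (intertwine_smul e h z)
  have hone : ∀ a, τ (blockRotation e y a) = blockRotation e x (τ a) := fun a =>
    congrArg (fun g : Perm α => g a) h
  -- after scaling to `x i = 1`, the rotations by multiples of `x` and `y` sweep out both blocks
  set b := e.symm (i, 0) with hb
  obtain ⟨a, ha⟩ := τ.surjective b
  set j := (e a).1 with hj
  have hy : y j ≠ 0 := by
    intro h0
    have h2 := hone a
    rw [(blockRotation_apply_eq_self e).2 h0, ha, eq_comm, blockRotation_apply_eq_self] at h2
    simp [hb, h1] at h2
  have hblock : ∀ c, (e c).1 = j ↔ (e (τ c)).1 = i := by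
    intro c
    constructor
    · intro hc
      have hca : c = blockRotation e ((((e c).2 - (e a).2) / y j) • y) a := by
        apply e.injective
        rw [apply_blockRotation, Prod.ext_iff]
        refine ⟨hc, ?_⟩
        simp [← hj, div_mul_cancel₀ _ hy]
      rw [hca, hz, ha, apply_blockRotation, hb]
      simp
    · intro hc
      have hca : τ c = blockRotation e ((e (τ c)).2 • x) b := by
        apply e.injective
        rw [apply_blockRotation, Prod.ext_iff, hb]
        simp [hc, h1]
      rw [← ha, ← hz] at hca
      rw [τ.injective hca, apply_blockRotation]
  refine ⟨j, y j, hy, ?_⟩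
  ext c
  rw [Perm.mul_apply, Perm.mul_apply]
  by_cases hc : (e c).1 = j
  · rw [blockRotation_congr e (x' := y) (by rw [hc, Pi.single_eq_same]), hone]
    exact blockRotation_congr e (by rw [(hblock c).1 hc, Pi.single_eq_same, h1])
  · rw [(blockRotation_apply_eq_self e).2 (Pi.single_eq_of_ne hc _),
      (blockRotation_apply_eq_self e).2 (Pi.single_eq_of_ne (fun h => hc ((hblock c).2 h)) _)]

variable [Fintype ι] [DecidableEq ι]

open Classical in
/-- The blocks whose rotation group is conjugated by `τ⁻¹` into the group of block rotations. -/
noncomputable def commonBlocks (τ : Perm α) : Finset ι :=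
  Finset.univ.filter fun i => ∃ y, τ * blockRotation e y = blockRotation e (Pi.single i 1) * τ

/-- The intersection of the group of block rotations with its conjugate by `τ` is the coordinate
subspace of the common blocks. -/
theorem exists_intertwine_iff [Fact p.Prime] {x : ι → ZMod p} {τ : Perm α} :
    (∃ y, τ * blockRotation e y = blockRotation e x * τ) ↔
      ∀ i, x i ≠ 0 → i ∈ commonBlocks e τ := by
  constructor
  · rintro ⟨y, h⟩ i hi
    obtain ⟨j, f, -, hf⟩ := exists_single_intertwine e h hi
    simpa [commonBlocks] using ⟨_, hf⟩
  · intro h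
    have key : ∀ s : Finset ι, ∃ y, τ * blockRotation e y =
        blockRotation e (∑ i ∈ s, Pi.single i (x i)) * τ := by
      intro s
      induction s using Finset.induction_on with
      | empty => exact ⟨0, by simp [blockRotation_zero]⟩
      | insert i s his ih =>
        obtain ⟨y, hy⟩ := ih
        have hi : ∃ z, τ * blockRotation e z = blockRotation e (Pi.single i (x i)) * τ := by
          by_cases h0 : x i = 0
          · exact ⟨0, by simp [h0, blockRotation_zero]⟩
          · obtain ⟨z, hz⟩ : ∃ y, τ * blockRotation e y =
                blockRotation e (Pi.single i 1) * τ := by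
              simpa [commonBlocks] using h i h0
            refine ⟨x i • z, ?_⟩
            rw [intertwine_smul e hz, ← Pi.single_smul, smul_eq_mul, mul_one]
        obtain ⟨z, hz⟩ := hi
        refine ⟨z + y, ?_⟩
        rw [Finset.sum_insert his, blockRotation_add, blockRotation_add, ← mul_assoc, hz,
          mul_assoc, hy, mul_assoc]
    obtain ⟨y, hy⟩ := key Finset.univ
    refine ⟨y, ?_⟩
    rwa [Finset.univ_sum_single] at hy

theorem hammingNorm_le_card_commonBlocks [Fact p.Prime] {x y : ι → ZMod p} {τ : Perm α}
    (h : τ * blockRotation e y = blockRotation e x * τ) :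
    hammingNorm x ≤ (commonBlocks e τ).card :=
  Finset.card_le_card fun i hi =>
    (exists_intertwine_iff e).1 ⟨y, h⟩ i (by simpa using hi)

open Classical in
/-- The Hamming weight enumerator of a coordinate subspace. -/
theorem sum_pow_hammingNorm [Fact p.Prime] (S : Finset ι) (r : ℝ) :
    ∑ x : ι → ZMod p with ∀ i, x i ≠ 0 → i ∈ S, r ^ hammingNorm x =
      (1 + ((p : ℝ) - 1) * r) ^ S.card := by
  -- the weight enumerator is a product over the coordinates
  have h1 : ∀ x : ι → ZMod p, (if ∀ i, x i ≠ 0 → i ∈ S then r ^ hammingNorm x else 0) =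
      ∏ i, if x i = 0 then 1 else if i ∈ S then r else 0 := by
    intro x
    split_ifs with hx
    · rw [hammingNorm, ← Finset.prod_const, Finset.prod_filter]
      refine Finset.prod_congr rfl fun i _ => ?_
      by_cases h0 : x i = 0
      · simp [h0]
      · simp [h0, hx i h0]
    · push Not at hx
      obtain ⟨i, h0, hi⟩ := hx
      exact (Finset.prod_eq_zero (Finset.mem_univ i) (by simp [h0, hi])).symm
  have h2 : ∀ i, ∑ z : ZMod p, (if z = 0 then (1 : ℝ) else if i ∈ S then r else 0) =
      if i ∈ S then 1 + ((p : ℝ) - 1) * r else 1 := by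
    intro i
    rw [← Finset.add_sum_erase _ _ (Finset.mem_univ (0 : ZMod p)), if_pos rfl]
    rw [Finset.sum_congr rfl (g := fun _ => if i ∈ S then r else 0)
      fun z hz => if_neg (Finset.ne_of_mem_erase hz)]
    have hp : 1 ≤ p := (Fact.out : p.Prime).one_le
    split_ifs <;> simp [Finset.card_erase_of_mem, ZMod.card, Nat.cast_sub hp]
  rw [Finset.sum_filter, Finset.sum_congr rfl fun x _ => h1 x]
  have h3 := Finset.prod_univ_sum (fun _ : ι => (Finset.univ : Finset (ZMod p)))
    fun i z => if z = 0 then (1 : ℝ) else if i ∈ S then r else 0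
  rw [Fintype.piFinset_univ] at h3
  rw [← h3, Finset.prod_congr rfl fun i _ => h2 i, Finset.prod_ite]
  simp

end BlockRotation

/-! ### Excess common blocks of a random intertwiner -/

section Excess

open Equiv

theorem sq_le_choose_mul {p : ℕ} (hp : 2 ≤ p) (n : ℕ) : n ^ 2 ≤ (n * p).choose p := by
  induction n with
  | zero => simp
  | succ n ih =>
    rcases Nat.eq_zero_or_pos n with rfl | hn
    · simp
    · -- two of the terms of Vandermonde's sum suffice
      have h1 : (n * p).choose p * p.choose 0 + (n * p).choose 1 * p.choose (p - 1) ≤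
          (n * p + p).choose p := by
        have hsub : ({(p, 0), (1, p - 1)} : Finset (ℕ × ℕ)) ⊆
            Finset.HasAntidiagonal.antidiagonal p := by
          intro ij hij
          simp only [Finset.mem_insert, Finset.mem_singleton] at hij
          rw [Finset.HasAntidiagonal.mem_antidiagonal]
          rcases hij with rfl | rfl <;> simp only <;> omega
        rw [Nat.add_choose_eq]
        exact (Finset.sum_pair (f := fun ij : ℕ × ℕ => (n * p).choose ij.1 * p.choose ij.2)
          (by rw [Ne, Prod.mk.injEq]; omega)).ge.trans (Finset.sum_le_sum_of_subset hsub)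
      have h2 : p.choose (p - 1) = p := by
        rw [Nat.choose_symm (show 1 ≤ p by omega), Nat.choose_one_right]
      rw [Nat.choose_zero_right, Nat.choose_one_right, h2] at h1
      rw [Nat.succ_mul]
      nlinarith [Nat.mul_le_mul hp hp, Nat.mul_le_mul_left n (Nat.mul_le_mul hp hp)]

variable {ι α : Type*} {p : ℕ} [Fintype α] [Fact p.Prime] (e : α ≃ ι × ZMod p)

theorem cycleType_blockRotation_single [DecidableEq ι] [DecidableEq α] (i : ι) :
    (blockRotation e (Pi.single i 1)).cycleType = {p} := by
  have hmem : ∀ a, blockRotation e (Pi.single i 1) a ≠ a ↔ (e a).1 = i := by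
    intro a
    rw [Ne, blockRotation_apply_eq_self]
    by_cases h : (e a).1 = i <;> simp [h]
  have hcyc : (blockRotation e (Pi.single i 1)).IsCycle := by
    refine ⟨e.symm (i, 0), (hmem _).2 (by simp), fun b hb => ⟨((e b).2.val : ℕ), ?_⟩⟩
    have hpow : ∀ n : ℕ, e ((blockRotation e (Pi.single i 1) ^ n) (e.symm (i, 0))) =
        (i, (n : ZMod p)) := by
      intro n
      induction n with
      | zero => simp
      | succ n ih => rw [pow_succ', Perm.mul_apply, apply_blockRotation, ih]; simp
    apply e.injective
    rw [zpow_natCast, hpow, ZMod.natCast_zmod_val, ← (hmem b).1 hb]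
  have hsupp : (blockRotation e (Pi.single i 1)).support =
      Finset.univ.image fun z : ZMod p => e.symm (i, z) := by
    ext a
    simp only [Perm.mem_support, hmem, Finset.mem_image, Finset.mem_univ, true_and]
    constructor
    · rintro rfl
      exact ⟨(e a).2, by simp⟩
    · rintro ⟨z, rfl⟩
      simp
  rw [hcyc.cycleType, hsupp, Finset.card_image_of_injective _ fun z z' h => by simpa using h,
    Finset.card_univ, ZMod.card]

variable [Fintype ι]

theorem card_fixed_blockRotation (x : ι → ZMod p) :
    Fintype.card {a // x (e a).1 = 0} = (Finset.univ.filter fun i => x i = 0).card * p := by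
  classical
  rw [Fintype.card_congr ((e.subtypeEquiv (q := fun b => x b.1 = 0) fun a => Iff.rfl).trans
    (Equiv.prodSubtypeFstEquivSubtypeProd (p := fun i => x i = 0))), Fintype.card_prod, ZMod.card,
    Fintype.card_subtype]

theorem card_zeros_eq_of_intertwine {x y : ι → ZMod p} {τ : Perm α}
    (h : τ * blockRotation e y = blockRotation e x * τ) :
    (Finset.univ.filter fun i => y i = 0).card = (Finset.univ.filter fun i => x i = 0).card := by
  have hp : 0 < p := (Fact.out : p.Prime).pos
  refine Nat.eq_of_mul_eq_mul_right hp ?_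
  rw [← card_fixed_blockRotation e, ← card_fixed_blockRotation e]
  refine Fintype.card_congr (τ.subtypeEquiv fun a => ?_)
  rw [← blockRotation_apply_eq_self e, ← blockRotation_apply_eq_self e, ← Perm.mul_apply _ τ,
    ← h, Perm.mul_apply, τ.injective.eq_iff]

variable [DecidableEq ι] [DecidableEq α]

/-- Let `τ` be a random intertwiner of two block rotations, and `i` a block fixed by the second
one, `x`. All `p`-cycles on the fixed points of `x` are equally likely to be the conjugate by `τ` of
a given permutation `z`, as they are conjugate to each other under the centralizer of `x`. -/
theorem card_cycles_mul_card_le (x y : ι → ZMod p) {i : ι} (hi : x i = 0) (z : Perm α) :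
    ((p - 1).factorial * ((Finset.univ.filter fun i => x i = 0).card * p).choose p) *
      (Finset.univ.filter fun τ : Perm α => τ * blockRotation e y = blockRotation e x * τ ∧
        τ * z = blockRotation e (Pi.single i 1) * τ).card ≤
      (Finset.univ.filter fun τ : Perm α =>
        τ * blockRotation e y = blockRotation e x * τ).card := by
  classical
  set P : α → Prop := fun a => x (e a).1 = 0 with hP
  set c := blockRotation e (Pi.single i 1) with hc
  have hPc : ∀ a, P (c a) ↔ P a := fun a => by simp [hP, hc, apply_blockRotation]
  set c' : Perm {a // P a} := c.subtypePerm hPc with hc'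
  have hcc : Perm.ofSubtype c' = c := by
    refine Perm.ofSubtype_subtypePerm _ fun a ha => ?_
    rw [Ne, hc, blockRotation_apply_eq_self] at ha
    by_cases h : (e a).1 = i
    · simpa only [hP, h] using hi
    · exact absurd (Pi.single_eq_of_ne h _) ha
  have hct : c'.cycleType = {p} := by
    rw [← Perm.cycleType_ofSubtype, hcc, cycleType_blockRotation_single]
  have hρ : ∀ d : Perm {a // P a}, d.cycleType = {p} → ∃ ρ, ρ * c' * ρ⁻¹ = d := fun d hd =>
    isConj_iff.1 (Perm.isConj_iff_cycleType_eq.2 (hct.trans hd.symm))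
  choose! ρ hρ using hρ
  have hcomm : ∀ d : Perm {a // P a},
      Perm.ofSubtype d * blockRotation e x = blockRotation e x * Perm.ofSubtype d := by
    intro d
    refine (Perm.Disjoint.commute fun a => ?_).eq
    by_cases h : P a
    · exact Or.inr ((blockRotation_apply_eq_self e).2 h)
    · exact Or.inl (Perm.ofSubtype_apply_of_not_mem d h)
  have hp2 : 2 ≤ p := (Fact.out : p.Prime).two_le
  have hcard : (Finset.univ.filter fun d : Perm {a // P a} => d.cycleType = {p}).card =
      (p - 1).factorial * ((Finset.univ.filter fun i => x i = 0).card * p).choose p := by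
    rw [Perm.card_of_cycleType_singleton hp2, card_fixed_blockRotation]
    rw [card_fixed_blockRotation]
    refine Nat.le_mul_of_pos_left _ (Finset.card_pos.2 ⟨i, by simpa using hi⟩)
  rw [← hcard, ← Finset.card_product]
  refine Finset.card_le_card_of_injOn (fun q => Perm.ofSubtype (ρ q.1) * q.2) ?_ ?_
  · rintro ⟨d, τ⟩ hq
    simp only [Finset.coe_product, Set.mem_prod, Finset.mem_coe, Finset.mem_filter,
      Finset.mem_univ, true_and] at hq ⊢
    rw [mul_assoc, hq.2.1, ← mul_assoc, hcomm, mul_assoc]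
  · rintro ⟨d, τ⟩ hq ⟨d', τ'⟩ hq' heq
    simp only [Finset.coe_product, Set.mem_prod, Finset.mem_coe, Finset.mem_filter,
      Finset.mem_univ, true_and] at hq hq' heq
    have hconj : ∀ d τ, d.cycleType = {p} → τ * z = c * τ →
        (Perm.ofSubtype (ρ d) * τ) * z * (Perm.ofSubtype (ρ d) * τ)⁻¹ = Perm.ofSubtype d := by
      intro d τ hd hτ
      have h1 : τ * z * τ⁻¹ = c := by rw [hτ, mul_inv_cancel_right]
      have h2 := congrArg Perm.ofSubtype (hρ d hd)
      rw [map_mul, map_mul, map_inv, hcc, ← h1] at h2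
      rw [← h2]
      group
    have hd : d = d' := Perm.ofSubtype_injective (by
      rw [← hconj d τ hq.1 hq.2.2, ← hconj d' τ' hq'.1 hq'.2.2, heq])
    subst hd
    rw [mul_left_cancel heq]

/-- A random intertwiner of two block rotations has few common blocks beyond those forced, by a
union bound over the rotations `Pi.single j f` and the blocks `i` they may be conjugated to. -/
theorem sum_excess_commonBlocks_le (x y : ι → ZMod p) :
    (p - 2).factorial * ∑ τ : Perm α with τ * blockRotation e y = blockRotation e x * τ,
      ((commonBlocks e τ).filter fun i => x i = 0).card ≤
      (Finset.univ.filter fun τ : Perm α =>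
        τ * blockRotation e y = blockRotation e x * τ).card := by
  classical
  set A := Finset.univ.filter fun τ : Perm α => τ * blockRotation e y = blockRotation e x * τ
    with hA
  set Z := Finset.univ.filter fun i => x i = 0 with hZ
  set Y := Finset.univ.filter fun i => y i = 0 with hY
  have hp2 : 2 ≤ p := (Fact.out : p.Prime).two_le
  rcases A.eq_empty_or_nonempty with h0 | ⟨τ₀, hτ₀⟩
  · simp [h0]
  have hYZ : Y.card = Z.card := card_zeros_eq_of_intertwine e (by simpa [hA] using hτ₀)
  have hdouble : ∑ τ ∈ A, ((commonBlocks e τ).filter fun i => x i = 0).card =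
      ∑ i ∈ Z, (A.filter fun τ => i ∈ commonBlocks e τ).card := by
    have h1 : ∀ τ, (commonBlocks e τ).filter (fun i => x i = 0) =
        Z.bipartiteAbove (fun τ i => i ∈ commonBlocks e τ) τ := by
      intro τ
      ext i
      simp [hZ, Finset.mem_bipartiteAbove, and_comm]
    simp only [h1]
    exact Finset.sum_card_bipartiteAbove_eq_sum_card_bipartiteBelow _
  have hcover : ∀ i ∈ Z, (A.filter fun τ => i ∈ commonBlocks e τ) ⊆
      (Y ×ˢ (Finset.univ.erase (0 : ZMod p))).biUnion fun jf =>
        Finset.univ.filter fun τ : Perm α => τ * blockRotation e y = blockRotation e x * τ ∧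
        τ * blockRotation e (Pi.single jf.1 jf.2) = blockRotation e (Pi.single i 1) * τ := by
    intro i hi τ hτ
    have hxi : x i = 0 := by simpa [hZ] using hi
    obtain ⟨hτA, hτi⟩ := Finset.mem_filter.1 hτ
    have hxy : τ * blockRotation e y = blockRotation e x * τ := by simpa [hA] using hτA
    obtain ⟨y', hy'⟩ : ∃ y, τ * blockRotation e y = blockRotation e (Pi.single i 1) * τ := by
      simpa [commonBlocks] using hτi
    obtain ⟨j, f, hf, hjf⟩ := exists_single_intertwine e hy' (by simp : (Pi.single i 1 :
      ι → ZMod p) i ≠ 0)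
    simp only [Finset.mem_biUnion, Finset.mem_product, Finset.mem_erase, Finset.mem_univ,
      Finset.mem_filter, true_and, and_true, Prod.exists]
    refine ⟨j, f, ⟨?_, hf⟩, hxy, hjf⟩
    rw [hY, Finset.mem_filter]
    refine ⟨Finset.mem_univ _, ?_⟩
    -- `τ` maps the block `j` into the block `i`, on which `x` does not move anything
    have hb := congrArg (fun g : Perm α => g (e.symm (j, 0))) hjf
    have hτb : (e (τ (e.symm (j, 0)))).1 = i := by
      by_contra hne
      simp only [Perm.mul_apply] at hb
      rw [(blockRotation_apply_eq_self e (a := τ _)).2 (Pi.single_eq_of_ne hne _),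
        τ.injective.eq_iff, blockRotation_apply_eq_self] at hb
      simp [hf] at hb
    have hb' := congrArg (fun g : Perm α => g (e.symm (j, 0))) hxy
    simp only [Perm.mul_apply] at hb'
    rw [(blockRotation_apply_eq_self e (a := τ _)).2 (by rw [hτb, hxi]), τ.injective.eq_iff,
      blockRotation_apply_eq_self] at hb'
    simpa using hb'
  have hbound : ∀ i ∈ Z, (p - 1).factorial * (Z.card * p).choose p *
      (A.filter fun τ => i ∈ commonBlocks e τ).card ≤ Z.card * (p - 1) * A.card := by
    intro i hi
    refine (Nat.mul_le_mul_left _ ((Finset.card_le_card (hcover i hi)).trans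
      Finset.card_biUnion_le)).trans ?_
    rw [Finset.mul_sum]
    refine (Finset.sum_le_card_nsmul _ _ _ fun jf _ => card_cycles_mul_card_le e x y
      (by simpa [hZ] using hi) _).trans_eq ?_
    rw [Finset.card_product, hYZ, Finset.card_erase_of_mem (Finset.mem_univ _),
      Finset.card_univ, ZMod.card, smul_eq_mul]
  rw [hdouble]
  rcases Z.eq_empty_or_nonempty with hZ0 | hZ0
  · simp [hZ0]
  have hpos : 0 < Z.card * (Z.card * (p - 1)) :=
    Nat.mul_pos hZ0.card_pos (Nat.mul_pos hZ0.card_pos (by omega))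
  refine Nat.le_of_mul_le_mul_left ?_ hpos
  have hfac : (p - 1).factorial = (p - 1) * (p - 2).factorial := by
    obtain ⟨q, rfl⟩ := Nat.exists_eq_add_of_le' hp2
    exact Nat.factorial_succ q
  set T := ∑ i ∈ Z, (A.filter fun τ => i ∈ commonBlocks e τ).card with hT
  calc Z.card * (Z.card * (p - 1)) * ((p - 2).factorial * T)
      = (p - 1).factorial * Z.card ^ 2 * T := by rw [hfac]; ring
    _ ≤ (p - 1).factorial * (Z.card * p).choose p * T :=
        Nat.mul_le_mul_right _ (Nat.mul_le_mul_left _ (sq_le_choose_mul hp2 _))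
    _ ≤ ∑ i ∈ Z, Z.card * (p - 1) * A.card := by
        rw [hT, Finset.mul_sum]
        exact Finset.sum_le_sum hbound
    _ = Z.card * (Z.card * (p - 1)) * A.card := by
        rw [Finset.sum_const, smul_eq_mul]; ring

end Excess

/-! ### Double cosets of a group of block rotations -/

section DoubleCosets

open Equiv

variable {α ι : Type*} {p : ℕ}

theorem doubleCosetAction_smul_eq_self {Γ : Type*} [Group Γ] (H : Subgroup Γ) (c : (H × H)ᵐᵒᵖ)
    (σ : Γ) : letI := doubleCosetAction H
    c • σ = σ ↔ σ * (c.unop.2 : Γ) = (c.unop.1 : Γ) * σ := by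
  change (c.unop.1 : Γ)⁻¹ * σ * (c.unop.2 : Γ) = σ ↔ _
  rw [mul_assoc, inv_mul_eq_iff_eq_mul]

theorem orbit_doubleCosetAction {Γ : Type*} [Group Γ] (H : Subgroup Γ) (σ : Γ) :
    letI := doubleCosetAction H
    MulAction.orbit (H × H)ᵐᵒᵖ σ = DoubleCoset.doubleCoset σ (H : Set Γ) (H : Set Γ) := by
  ext τ
  rw [DoubleCoset.mem_doubleCoset]
  constructor
  · rintro ⟨c, rfl⟩
    exact ⟨_, H.inv_mem c.unop.1.2, _, c.unop.2.2, rfl⟩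
  · rintro ⟨h, hh, g, hg, rfl⟩
    refine ⟨MulOpposite.op (⟨h⁻¹, H.inv_mem hh⟩, ⟨g, hg⟩), ?_⟩
    change (h⁻¹)⁻¹ * σ * g = h * σ * g
    rw [inv_inv]

/-- The coordinates of the elements of a group of block rotations. -/
noncomputable def rotationEquiv (e : α ≃ ι × ZMod p) (H : Subgroup (Perm α))
    (hH : ∀ τ, τ ∈ H ↔ ∃ x, blockRotation e x = τ) : (ι → ZMod p) ≃ H :=
  Equiv.ofBijective (fun x => ⟨blockRotation e x, (hH _).2 ⟨x, rfl⟩⟩)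
    ⟨fun _ _ h => blockRotation_injective e (congrArg Subtype.val h),
      fun ⟨τ, hτ⟩ => ((hH τ).1 hτ).imp fun _ h => Subtype.ext h⟩

theorem blockRotation_rotationEquiv_symm (e : α ≃ ι × ZMod p) (H : Subgroup (Perm α))
    (hH : ∀ τ, τ ∈ H ↔ ∃ x, blockRotation e x = τ) (h : H) :
    blockRotation e ((rotationEquiv e H hH).symm h) = h :=
  congrArg Subtype.val ((rotationEquiv e H hH).apply_symm_apply h)

variable [Fintype α] [DecidableEq α] [Fintype ι] [DecidableEq ι] [Fact p.Prime]

theorem hasHammingStabilizers_doubleCoset (e : α ≃ ι × ZMod p) (H : Subgroup (Perm α))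
    (hH : ∀ τ, τ ∈ H ↔ ∃ x, blockRotation e x = τ) [Fintype (H × H)ᵐᵒᵖ] :
    letI := doubleCosetAction H
    HasHammingStabilizers (G := (H × H)ᵐᵒᵖ) (X := Perm α) (fun σ => (commonBlocks e σ).card)
      (fun c => hammingNorm ((rotationEquiv e H hH).symm c.unop.1)) p
      (1 / ((p - 2).factorial : ℝ)) := by
  classical
  let _ := doubleCosetAction H
  set Ψ := rotationEquiv e H hH with hΨ
  have hsmul : ∀ (c : (H × H)ᵐᵒᵖ) (σ : Perm α), c • σ = σ ↔
      σ * blockRotation e (Ψ.symm c.unop.2) = blockRotation e (Ψ.symm c.unop.1) * σ := by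
    intro c σ
    rw [hΨ, blockRotation_rotationEquiv_symm, blockRotation_rotationEquiv_symm]
    exact doubleCosetAction_smul_eq_self H c σ
  refine ⟨fun c σ h => hammingNorm_le_card_commonBlocks e ((hsmul c σ).1 h), fun σ r => ?_,
    fun c => ?_⟩
  · rw [← sum_pow_hammingNorm (p := p)]
    refine Finset.sum_bij (fun c _ => Ψ.symm c.unop.1) ?_ ?_ ?_ fun _ _ => rfl
    · intro c hc
      simp only [Finset.mem_filter, Finset.mem_univ, true_and] at hc ⊢
      exact (exists_intertwine_iff e).1 ⟨_, (hsmul c σ).1 hc⟩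
    · intro c hc d hd hcd
      simp only [Finset.mem_filter, Finset.mem_univ, true_and, hsmul] at hc hd
      rw [← hcd, ← hc] at hd
      have h2 := Ψ.symm.injective (blockRotation_injective e (mul_left_cancel hd))
      exact MulOpposite.unop_injective (Prod.ext (Ψ.symm.injective hcd) h2.symm)
    · intro x hx
      simp only [Finset.mem_filter, Finset.mem_univ, true_and] at hx
      obtain ⟨y, hy⟩ := (exists_intertwine_iff e).2 hx
      refine ⟨MulOpposite.op (Ψ x, Ψ y), ?_, by simp⟩
      simp only [Finset.mem_filter, Finset.mem_univ, true_and, hsmul]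
      simpa using hy
  · set x := Ψ.symm c.unop.1 with hx
    set y := Ψ.symm c.unop.2 with hy
    have hA : (@Finset.filter _ (fun σ : Perm α => c • σ = σ) (Classical.decPred _)
        Finset.univ) = Finset.univ.filter fun σ : Perm α =>
          σ * blockRotation e y = blockRotation e x * σ :=
      Finset.ext fun σ => by simp [hsmul, hx, hy]
    have hsub : ∀ σ ∈ Finset.univ.filter fun σ : Perm α =>
        σ * blockRotation e y = blockRotation e x * σ,
        ((commonBlocks e σ).card : ℝ) - hammingNorm x =
          (((commonBlocks e σ).filter fun i => x i = 0).card : ℝ) := by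
      intro σ hσ
      have hσ' := (exists_intertwine_iff e).1 ⟨y, (Finset.mem_filter.1 hσ).2⟩
      have h1 : hammingNorm x = ((commonBlocks e σ).filter fun i => ¬x i = 0).card := by
        rw [hammingNorm]
        congr 1
        ext i
        simpa using hσ' i
      rw [h1, ← Finset.card_filter_add_card_filter_not (s := commonBlocks e σ) (fun i => x i = 0)]
      push_cast
      ring
    have hpos : (0 : ℝ) < ((p - 2).factorial : ℝ) := by exact_mod_cast Nat.factorial_pos _
    rw [hA, Finset.sum_congr rfl hsub, one_div, inv_mul_eq_div, le_div_iff₀ hpos, mul_comm]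
    exact_mod_cast sum_excess_commonBlocks_le e x y

end DoubleCosets

/-! ### Sylow subgroups of the symmetric group -/

section SylowSymmetric

open Equiv

/-- For `k < p` a Sylow `p`-subgroup of the symmetric group of degree `p * k` is generated by `k`
disjoint `p`-cycles. -/
theorem exists_blockRotation_of_sylow {p k : ℕ} [Fact p.Prime] (hkp : k < p)
    (H : Sylow p (Perm (Fin (p * k)))) :
    ∃ e : Fin (p * k) ≃ Fin k × ZMod p, ∀ τ, τ ∈ (H : Subgroup (Perm (Fin (p * k)))) ↔
      ∃ x, blockRotation e x = τ := by
  have hp : p.Prime := Fact.out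
  let e₀ : Fin (p * k) ≃ Fin k × ZMod p := Fintype.equivOfCardEq (by
    rw [Fintype.card_prod, ZMod.card, Fintype.card_fin, Fintype.card_fin, mul_comm])
  let φ : Multiplicative (Fin k → ZMod p) →* Perm (Fin (p * k)) :=
    { toFun := fun x => blockRotation e₀ x.toAdd
      map_one' := blockRotation_zero e₀
      map_mul' := fun x y => blockRotation_add e₀ x.toAdd y.toAdd }
  have hφ : Function.Injective φ := fun x y h => blockRotation_injective e₀ h
  have hcard : Nat.card φ.range = p ^ (Nat.card (Perm (Fin (p * k)))).factorization p := by
    rw [← Nat.card_congr (MonoidHom.ofInjective hφ).toEquiv, Nat.card_perm, Nat.card_fin,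
      Nat.factorization_factorial_mul hp, Nat.factorization_factorial_eq_zero_of_lt hkp,
      zero_add, Nat.card_congr Multiplicative.toAdd, Nat.card_fun, Nat.card_zmod, Nat.card_fin]
  obtain ⟨g, hg⟩ := MulAction.exists_smul_eq (Perm (Fin (p * k)))
    (Sylow.ofCard φ.range hcard) H
  -- conjugating the rotations by `g` amounts to relabelling the points by `g⁻¹`
  refine ⟨(g⁻¹ : Perm (Fin (p * k))).trans e₀, fun τ => ?_⟩
  have hconj : ∀ x, blockRotation ((g⁻¹ : Perm (Fin (p * k))).trans e₀) x =
      g * blockRotation e₀ x * g⁻¹ := by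
    intro x
    ext a
    rfl
  rw [← hg, Sylow.coe_subgroup_smul, Sylow.coe_ofCard, Subgroup.mem_pointwise_smul_iff_inv_smul_mem,
    MonoidHom.mem_range]
  constructor
  · rintro ⟨x, hx⟩
    refine ⟨x.toAdd, ?_⟩
    have hx' : blockRotation e₀ x.toAdd = g⁻¹ * τ * g := by
      refine hx.trans ?_
      simp [MulAut.smul_def, ← map_inv]
    rw [hconj, hx']
    group
  · rintro ⟨x, rfl⟩
    refine ⟨Multiplicative.ofAdd x, ?_⟩
    change blockRotation e₀ x = _
    rw [hconj, ← map_inv, MulAut.smul_def, MulAut.conj_apply]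
    group

end SylowSymmetric

/-! ### Mixing of the Burnside process -/

theorem mainTheorem2 (p k : ℕ) [Fact p.Prime] (hp : 11 ≤ p) (hk : 1 ≤ k) (hkp : k < p)
    (H : Sylow p (Equiv.Perm (Fin (p * k)))) (σ : Equiv.Perm (Fin (p * k))) (a : ℕ)
    (ha : (DoubleCoset.doubleCoset σ (H : Set (Equiv.Perm (Fin (p * k))))
      (H : Set (Equiv.Perm (Fin (p * k))))).ncard = p ^ a)
    (t : ℕ) (ht : 1 ≤ t) :
    |tvDist ((doubleCosetKernel (H : Subgroup (Equiv.Perm (Fin (p * k)))) ^ t) σ)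
          (doubleCosetStationary (H : Subgroup (Equiv.Perm (Fin (p * k))))) -
        1 + (1 - (1 - 1 / (p : ℝ)) ^ t) ^ (2 * k - a)| ≤
      4 * (p : ℝ) ^ 4 / ((p - 1).factorial : ℝ) + (t : ℝ) / ((p - 2).factorial : ℝ) ∧
    tvDist ((doubleCosetKernel (H : Subgroup (Equiv.Perm (Fin (p * k)))) ^ t) σ)
          (doubleCosetStationary (H : Subgroup (Equiv.Perm (Fin (p * k))))) ≤
      1 - (1 - (1 - 1 / (p : ℝ)) ^ t) ^ (2 * k - a) +
        4 * (p : ℝ) ^ 4 / ((p - 1).factorial : ℝ) + (t : ℝ) / ((p - 2).factorial : ℝ) := by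
  classical
  have hprime : p.Prime := Fact.out
  obtain ⟨e, he⟩ := exists_blockRotation_of_sylow hkp H
  set K : Subgroup (Equiv.Perm (Fin (p * k))) := ↑H with hK
  let _ : Fintype (K × K)ᵐᵒᵖ := Fintype.ofEquiv _ MulOpposite.opEquiv
  let _ := doubleCosetAction K
  have hH := hasHammingStabilizers_doubleCoset e K he
  have hD : (commonBlocks e σ).card = 2 * k - a := by
    have h1 := MulAction.card_orbit_mul_card_stabilizer_eq_card_group (K × K)ᵐᵒᵖ σ
    rw [← Nat.card_eq_fintype_card, ← Nat.card_eq_fintype_card,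
      ← Nat.card_eq_fintype_card] at h1
    have h2 : Nat.card (MulAction.orbit (K × K)ᵐᵒᵖ σ) = p ^ a := by
      rw [Nat.card_coe_set_eq, orbit_doubleCosetAction]
      exact ha
    have h3 : Nat.card (MulAction.stabilizer (K × K)ᵐᵒᵖ σ) = p ^ (commonBlocks e σ).card := by
      exact_mod_cast hH.card_stabilizer σ
    have h4 : Nat.card K = p ^ k := by
      rw [← Nat.card_congr (rotationEquiv e K he), Nat.card_fun, Nat.card_zmod, Nat.card_fin]
    have h5 : Nat.card (K × K)ᵐᵒᵖ = p ^ (2 * k) := by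
      rw [← Nat.card_congr MulOpposite.opEquiv, Nat.card_prod, h4, two_mul, pow_add]
    rw [h2, h3, h5, ← pow_add] at h1
    have h6 : a + (commonBlocks e σ).card = 2 * k := Nat.pow_right_injective hprime.two_le h1
    omega
  have hmain : |tvDist ((doubleCosetKernel K ^ t) σ) (doubleCosetStationary K) - 1 +
      (1 - (1 - 1 / (p : ℝ)) ^ t) ^ (commonBlocks e σ).card| ≤
      p * (1 / ((p - 2).factorial : ℝ)) + t * (1 / ((p - 2).factorial : ℝ)) :=
    hH.abs_tvDist_sub_le hprime.one_le ht σ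
  rw [hD] at hmain
  have hfac : ((p - 1).factorial : ℝ) = ((p : ℝ) - 1) * ((p - 2).factorial : ℝ) := by
    obtain ⟨q, rfl⟩ := Nat.exists_eq_add_of_le' hprime.two_le
    have : (q + 2 - 1).factorial = (q + 1) * (q + 2 - 2).factorial := Nat.factorial_succ q
    rw [this]
    push_cast
    ring
  have hp1 : (11 : ℝ) ≤ p := by exact_mod_cast hp
  have hpos : (0 : ℝ) < ((p - 2).factorial : ℝ) := by exact_mod_cast Nat.factorial_pos _
  have hbound : (p : ℝ) * (1 / ((p - 2).factorial : ℝ)) ≤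
      4 * (p : ℝ) ^ 4 / ((p - 1).factorial : ℝ) := by
    rw [hfac, mul_one_div, div_le_div_iff₀ hpos (by nlinarith), ← mul_assoc]
    refine mul_le_mul_of_nonneg_right ?_ hpos.le
    have h2 : (p : ℝ) ^ 2 ≤ (p : ℝ) ^ 4 := pow_le_pow_right₀ (by linarith) (by norm_num)
    nlinarith
  have habs := hmain.trans (add_le_add_left hbound _)
  rw [mul_one_div] at habs
  exact ⟨habs, by linarith [(abs_le.1 habs).2]⟩
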